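/- Let $A$ be a (not necessarily unital) $C^*$-algebra with positive cone $A_+$, and let $\gamma=(\gamma_t)_{t\in\mathbb R}$ be a one-parameter group of $*$-automorphisms of $A$ such that $t\mapsto\gamma_t(a)$ is norm continuous for every $a\in A$. Let $D\subseteq A$ be an abelian $C^*$-subalgebra and let $P:A\to D$ be a conditional expectation, i.e. a positive contractive linear map with $P(d)=d$, $P(da)=dP(a)$ and $P(ad)=P(a)d$ for all $a\in A$, $d\in D$. A weight on $A$ is a map $\psi:A_+\to[0,\infty]$ with $\psi(a+b)=\psi(a)+\psi(b)$ and $\psi(\lambda a)=\lambda\psi(a)$ for all $a,b\in A_+$ and all real $\lambda>0$. It is proper if it is non-zero, densely defined ($\{a\in A_+:\psi(a)<\infty\}$ is dense in $A_+$) and lower semi-continuous, and faithful if $a\in A_+$ and $\psi(a)=0$ imply $a=0$. For a proper weight $\psi$ put $\mathcal N_\psi=\{a\in A:\psi(a^*a)<\infty\}$ and $\mathcal M_\psi=\operatorname{span}\{a^*b:a,b\in\mathcal N_\psi\}$, and write $\psi$ also for the unique linear map $\mathcal M_\psi\to\mathbb C$ which extends $\psi:\mathcal M_\psi\cap A_+\to[0,\infty)$.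 For $\beta\in\mathbb R$, a $\beta$-KMS weight for $\gamma$ is a proper weight $\psi$ on $A$ such that 1. $\psi\circ\gamma_t=\psi$ on $A_+$ for all $t\in\mathbb R$, and 2. for all $a,b\in\mathcal N_\psi\cap\mathcal N_\psi^*$ there is a bounded continuous function $F$ on the closed strip of all $z\in\mathbb C$ whose imaginary part lies between $0$ and $\beta$, holomorphic in the interior of the strip, such that $F(t)=\psi(a\gamma_t(b))$ and $F(t+i\beta)=\psi(\gamma_t(b)a)$ for all $t\in\mathbb R$. Let $\beta\in\mathbb R$, $\beta\neq0$, and let $\omega$ be a faithful $\beta$-KMS weight for $\gamma$ such that $\omega\circ P=\omega$ on $A_+$. Then $\gamma_t(d)=d$ for all $t\in\mathbb R$ and all $d\in D$. -/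

import Mathlib

open scoped ENNReal

/-- A weight on a C*-algebra `A`: a map from the positive cone of `A` to `[0, ∞]` which is additive
and homogeneous for strictly positive scalars. -/
structure CStarWeight (A : Type*) [NonUnitalCStarAlgebra A] [PartialOrder A]
    [StarOrderedRing A] where
  toFun : {a : A // 0 ≤ a} → ℝ≥0∞
  map_add : ∀ a b : {a : A // 0 ≤ a}, toFun (a + b) = toFun a + toFun b
  map_smul : ∀ (r : ℝ) (hr : 0 < r) (a : {a : A // 0 ≤ a}),
    toFun ⟨r • (a : A), smul_nonneg hr.le a.2⟩ = ENNReal.ofReal r * toFun a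

/-- A one-parameter group of *-automorphisms of `A` for which all orbit maps `t ↦ γ_t(a)` are
norm continuous. -/
structure OneParameterAutGroup (A : Type*) [NonUnitalCStarAlgebra A] where
  toFun : ℝ → (A ≃⋆ₐ[ℂ] A)
  map_add : ∀ s t : ℝ, toFun (s + t) = toFun s * toFun t
  continuous_orbit : ∀ a : A, Continuous fun t : ℝ => toFun t a

/-- A conditional expectation of `A` onto the *-subalgebra `D`: a positive contractive linear
map `A → D` which is the identity on `D` and a `D`-bimodule map. -/
structure IsConditionalExpectation {A : Type*} [NonUnitalCStarAlgebra A] [PartialOrder A]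
    [StarOrderedRing A] (D : NonUnitalStarSubalgebra ℂ A) (P : A →ₗ[ℂ] D) : Prop where
  apply_self : ∀ d : D, P (d : A) = d
  norm_le : ∀ a : A, ‖(P a : A)‖ ≤ ‖a‖
  nonneg : ∀ a : A, 0 ≤ a → 0 ≤ (P a : A)
  map_mul_left : ∀ (d : D) (a : A), P ((d : A) * a) = d * P a
  map_mul_right : ∀ (a : A) (d : D), P (a * (d : A)) = P a * d

namespace CStarWeight

section

variable {A : Type*} [NonUnitalCStarAlgebra A] [PartialOrder A] [StarOrderedRing A]

/-- Proper weights: non-zero, densely defined and lower semi-continuous (the positive cone carries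
the norm topology). -/
structure IsProper (ψ : CStarWeight A) : Prop where
  ne_zero : ∃ a, ψ.toFun a ≠ 0
  dense : Dense {a : {a : A // 0 ≤ a} | ψ.toFun a < ∞}
  lowerSemicontinuous : LowerSemicontinuous ψ.toFun

/-- Faithful weights. -/
def IsFaithful (ψ : CStarWeight A) : Prop :=
  ∀ a : {a : A // 0 ≤ a}, ψ.toFun a = 0 → (a : A) = 0

/-- The set `N_ψ` of elements `a` with `ψ(a* a) < ∞`. -/
def nSet (ψ : CStarWeight A) : Set A :=
  {a | ψ.toFun ⟨star a * a, star_mul_self_nonneg a⟩ < ∞}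

/-- The space `M_ψ`, the linear span of the products `a* b` with `a, b ∈ N_ψ`. -/
def mSpan (ψ : CStarWeight A) : Submodule ℂ A :=
  Submodule.span ℂ {x | ∃ a ∈ ψ.nSet, ∃ b ∈ ψ.nSet, x = star a * b}

lemma map_zero {ψ : CStarWeight A} (hψ : ψ.IsProper) : ψ.toFun 0 = 0 := by
  obtain ⟨a, ha⟩ := hψ.dense.nonempty_iff.2 ⟨0⟩
  have h := ψ.map_add a 0
  rw [add_zero] at h
  have ha' : ψ.toFun a ≠ ∞ := ne_of_lt ha
  have h' : ψ.toFun a + ψ.toFun 0 = ψ.toFun a + 0 := by rw [← h, add_zero]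
  exact (ENNReal.add_right_inj ha').1 h'

lemma mono (ψ : CStarWeight A) {a b : A} (ha : 0 ≤ a) (hb : 0 ≤ b) (hab : a ≤ b) :
    ψ.toFun ⟨a, ha⟩ ≤ ψ.toFun ⟨b, hb⟩ := by
  have h := ψ.map_add ⟨a, ha⟩ ⟨b - a, sub_nonneg.2 hab⟩
  have e : (⟨a, ha⟩ + ⟨b - a, sub_nonneg.2 hab⟩ : {a : A // 0 ≤ a}) = ⟨b, hb⟩ :=
    Subtype.ext (by simp)
  rw [e] at h
  rw [h]
  exact le_self_add

/-- The positive elements of finite weight. -/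
def finCone (ψ : CStarWeight A) : Set {a : A // 0 ≤ a} := {a | ψ.toFun a < ∞}

lemma toFun_sum {ψ : CStarWeight A} (hψ : ψ.IsProper) {ι : Type*} (s : Finset ι) (r : ι → ℝ)
    (hr : ∀ i, 0 ≤ r i) (a : ι → {a : A // 0 ≤ a})
    (h : 0 ≤ ∑ i ∈ s, r i • (a i : A)) :
    ψ.toFun ⟨∑ i ∈ s, r i • (a i : A), h⟩ = ∑ i ∈ s, ENNReal.ofReal (r i) * ψ.toFun (a i) := by
  classical
  induction s using Finset.induction_on with
  | empty => exact (congrArg ψ.toFun (Subtype.ext (by simp))).trans (map_zero hψ)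
  | insert i s hi ih =>
    have h0 : 0 ≤ ∑ i ∈ s, r i • (a i : A) :=
      Finset.sum_nonneg fun i _ => smul_nonneg (hr i) (a i).2
    have h1 : 0 ≤ r i • (a i : A) := smul_nonneg (hr i) (a i).2
    have e : (⟨∑ i ∈ insert i s, r i • (a i : A), h⟩ : {a : A // 0 ≤ a}) =
        ⟨r i • (a i : A), h1⟩ + ⟨∑ i ∈ s, r i • (a i : A), h0⟩ :=
      Subtype.ext (by simp [Finset.sum_insert hi])
    rw [e, ψ.map_add, ih h0, Finset.sum_insert hi]
    congr 1
    rcases (hr i).eq_or_lt with h2 | h2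
    · have e2 : (⟨r i • (a i : A), h1⟩ : {a : A // 0 ≤ a}) = 0 :=
        Subtype.ext (by simp [← h2])
      rw [e2, map_zero hψ, ← h2]
      simp
    · exact ψ.map_smul (r i) h2 (a i)

lemma smul_mem_nSet {ψ : CStarWeight A} {a : A} (ha : a ∈ ψ.nSet) {c : ℂ} (hc : c ≠ 0) :
    c • a ∈ ψ.nSet := by
  have hc' : 0 < ‖c‖ ^ 2 := by positivity
  have e : (⟨star (c • a) * (c • a), star_mul_self_nonneg _⟩ : {a : A // 0 ≤ a}) =
      ⟨(‖c‖ ^ 2 : ℝ) • (star a * a), smul_nonneg hc'.le (star_mul_self_nonneg a)⟩ := by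
    apply Subtype.ext
    have h : star c * c = ((‖c‖ ^ 2 : ℝ) : ℂ) := by
      simpa using Complex.conj_mul' c
    simp only [star_smul, smul_mul_smul_comm]
    rw [h]
    exact Complex.coe_smul _ _
  have h := ψ.map_smul (‖c‖ ^ 2) hc' ⟨star a * a, star_mul_self_nonneg a⟩
  change ψ.toFun _ < ∞
  rw [e, h]
  exact ENNReal.mul_lt_top ENNReal.ofReal_lt_top ha

lemma add_mem_nSet {ψ : CStarWeight A} {a b : A} (ha : a ∈ ψ.nSet) (hb : b ∈ ψ.nSet) :
    a + b ∈ ψ.nSet := by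
  have h1 := star_mul_self_nonneg (a + b)
  have h2 := star_mul_self_nonneg (a - b)
  have ea := star_mul_self_nonneg a
  have eb := star_mul_self_nonneg b
  have h3 : star (a + b) * (a + b) ≤
      (star a * a + star b * b) + (star a * a + star b * b) := by
    rw [← sub_nonneg]
    convert h2 using 1
    simp only [star_add, star_sub]
    noncomm_ring
  refine lt_of_le_of_lt (ψ.mono h1 (add_nonneg (add_nonneg ea eb) (add_nonneg ea eb)) h3) ?_
  have h4 := ψ.map_add (⟨_, ea⟩ + ⟨_, eb⟩) (⟨_, ea⟩ + ⟨_, eb⟩)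
  refine lt_of_eq_of_lt h4 ?_
  rw [ψ.map_add]
  exact ENNReal.add_lt_top.2 ⟨ENNReal.add_lt_top.2 ⟨ha, hb⟩, ENNReal.add_lt_top.2 ⟨ha, hb⟩⟩

lemma finCone_mem_mSpan {ψ : CStarWeight A} {a : {a : A // 0 ≤ a}} (ha : a ∈ ψ.finCone) :
    (a : A) ∈ ψ.mSpan := by
  have h : star (CFC.sqrt (a : A)) * CFC.sqrt (a : A) = a := by
    rw [(IsSelfAdjoint.of_nonneg (CFC.sqrt_nonneg (a : A))).star_eq]
    exact CFC.sqrt_mul_sqrt_self (a : A) a.2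
  have hN : CFC.sqrt (a : A) ∈ ψ.nSet := by
    change ψ.toFun _ < ∞
    simp only [h]
    exact ha
  exact Submodule.subset_span ⟨_, hN, _, hN, h.symm⟩

lemma mSpan_eq (ψ : CStarWeight A) :
    ψ.mSpan = Submodule.span ℂ (Set.range fun a : ψ.finCone => ((a : {a : A // 0 ≤ a}) : A)) := by
  apply le_antisymm
  · refine Submodule.span_le.2 ?_
    rintro x ⟨b, hb, a, ha, rfl⟩
    have key : ∀ c : A, c ∈ ψ.nSet → star c * c ∈
        Submodule.span ℂ (Set.range fun a : ψ.finCone => ((a : {a : A // 0 ≤ a}) : A)) :=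
      fun c hc => Submodule.subset_span ⟨⟨⟨_, star_mul_self_nonneg c⟩, hc⟩, rfl⟩
    have e : star b * a = (1 / 4 : ℂ) • (star (a + b) * (a + b))
        + (-1 / 4 : ℂ) • (star (a + (-1 : ℂ) • b) * (a + (-1 : ℂ) • b))
        + (Complex.I / 4 : ℂ) • (star (a + Complex.I • b) * (a + Complex.I • b))
        + (-Complex.I / 4 : ℂ) •
          (star (a + (-Complex.I) • b) * (a + (-Complex.I) • b)) := by
      simp only [star_add, star_smul, add_mul, mul_add, smul_mul_assoc, mul_smul_comm,
        smul_add, smul_smul, star_neg, star_one, Complex.star_def, Complex.conj_I]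
      match_scalars <;> ring_nf <;> simp [Complex.I_sq] <;> norm_num
    rw [e]
    refine add_mem (add_mem (add_mem ?_ ?_) ?_) ?_ <;>
      refine Submodule.smul_mem _ _ (key _ ?_)
    · exact add_mem_nSet ha hb
    all_goals exact add_mem_nSet ha (smul_mem_nSet hb (by simp))
  · refine Submodule.span_le.2 ?_
    rintro _ ⟨a, rfl⟩
    exact finCone_mem_mSpan a.2

/-- The real part of a complex combination of positive elements which is self-adjoint. -/
lemma sum_re_smul {ι : Type*} (s : Finset ι) (c : ι → ℂ) (a : ι → {a : A // 0 ≤ a}) {x : A}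
    (hx : IsSelfAdjoint x) (h : ∑ i ∈ s, c i • (a i : A) = x) :
    ∑ i ∈ s, (c i).re • (a i : A) = x := by
  have h1 : ∑ i ∈ s, star (c i) • (a i : A) = x := by
    have := congrArg star h
    rw [hx.star_eq] at this
    rw [← this, star_sum]
    refine Finset.sum_congr rfl fun i _ => ?_
    rw [star_smul, (IsSelfAdjoint.of_nonneg (a i).2).star_eq]
  have h2 : (2 : ℝ) • ∑ i ∈ s, (c i).re • (a i : A) = (2 : ℝ) • x := by
    calc (2 : ℝ) • ∑ i ∈ s, (c i).re • (a i : A)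
        = ∑ i ∈ s, c i • (a i : A) + ∑ i ∈ s, star (c i) • (a i : A) := by
          rw [Finset.smul_sum, ← Finset.sum_add_distrib]
          refine Finset.sum_congr rfl fun i _ => ?_
          rw [← add_smul, smul_smul, ← Complex.coe_smul]
          congr 1
          rw [Complex.star_def, Complex.add_conj]
      _ = (2 : ℝ) • x := by rw [h, h1, two_smul]
  exact smul_right_injective A (two_ne_zero (α := ℝ)) h2

lemma toFun_lt_top_of_mem {ψ : CStarWeight A} (hψ : ψ.IsProper) {a : {a : A // 0 ≤ a}}
    (ha : (a : A) ∈ ψ.mSpan) : ψ.toFun a < ∞ := by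
  rw [mSpan_eq, Finsupp.mem_span_range_iff_exists_finsupp] at ha
  obtain ⟨c, hc⟩ := ha
  have h := sum_re_smul c.support c (fun i => (i : {a : A // 0 ≤ a}))
    (IsSelfAdjoint.of_nonneg a.2) hc
  have h0 : 0 ≤ ∑ i ∈ c.support, max (c i).re 0 • ((i : {a : A // 0 ≤ a}) : A) :=
    Finset.sum_nonneg fun i _ => smul_nonneg (le_max_right _ _) i.1.2
  have hle : (a : A) ≤ ∑ i ∈ c.support, max (c i).re 0 • ((i : {a : A // 0 ≤ a}) : A) := by
    rw [← h]
    exact Finset.sum_le_sum fun i _ => smul_le_smul_of_nonneg_right (le_max_left _ _) i.1.2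
  refine lt_of_le_of_lt (ψ.mono a.2 h0 hle) ?_
  rw [toFun_sum hψ c.support (fun i => max (c i).re 0) (fun i => le_max_right _ _)
    (fun i => (i : {a : A // 0 ≤ a})) h0]
  exact ENNReal.sum_lt_top.2 fun i _ => ENNReal.mul_lt_top ENNReal.ofReal_lt_top i.2

lemma toReal_sum {ψ : CStarWeight A} (hψ : ψ.IsProper) (s : Finset ψ.finCone)
    (r : ψ.finCone → ℝ) (hr : ∀ i, 0 ≤ r i)
    (h : 0 ≤ ∑ i ∈ s, r i • ((i : {a : A // 0 ≤ a}) : A)) :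
    (ψ.toFun ⟨∑ i ∈ s, r i • ((i : {a : A // 0 ≤ a}) : A), h⟩).toReal =
      ∑ i ∈ s, r i * (ψ.toFun i).toReal := by
  rw [toFun_sum hψ s r hr (fun i => (i : {a : A // 0 ≤ a})) h, ENNReal.toReal_sum]
  · refine Finset.sum_congr rfl fun i _ => ?_
    rw [ENNReal.toReal_mul, ENNReal.toReal_ofReal (hr i)]
  · exact fun i _ => (ENNReal.mul_lt_top ENNReal.ofReal_lt_top i.2).ne

lemma sum_real_eq_zero {ψ : CStarWeight A} (hψ : ψ.IsProper) (s : Finset ψ.finCone)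
    (r : ψ.finCone → ℝ) (h : ∑ i ∈ s, r i • ((i : {a : A // 0 ≤ a}) : A) = 0) :
    ∑ i ∈ s, r i * (ψ.toFun i).toReal = 0 := by
  have hp : 0 ≤ ∑ i ∈ s, max (r i) 0 • ((i : {a : A // 0 ≤ a}) : A) :=
    Finset.sum_nonneg fun i _ => smul_nonneg (le_max_right _ _) i.1.2
  have hn : 0 ≤ ∑ i ∈ s, max (-r i) 0 • ((i : {a : A // 0 ≤ a}) : A) :=
    Finset.sum_nonneg fun i _ => smul_nonneg (le_max_right _ _) i.1.2
  have hd : ∀ x : ℝ, x = max x 0 - max (-x) 0 := fun x => by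
    rcases le_total x 0 with hx | hx
    · rw [max_eq_right hx, max_eq_left (by linarith)]; ring
    · rw [max_eq_left hx, max_eq_right (by linarith)]; ring
  have e : ∑ i ∈ s, max (r i) 0 • ((i : {a : A // 0 ≤ a}) : A) =
      ∑ i ∈ s, max (-r i) 0 • ((i : {a : A // 0 ≤ a}) : A) := by
    rw [← sub_eq_zero, ← Finset.sum_sub_distrib]
    refine Eq.trans (Finset.sum_congr rfl fun i _ => ?_) h
    rw [← sub_smul, ← hd]
  have e1 := toReal_sum hψ s (fun i => max (r i) 0) (fun i => le_max_right _ _) hp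
  have e2 := toReal_sum hψ s (fun i => max (-r i) 0) (fun i => le_max_right _ _) hn
  have e3 : ∑ i ∈ s, max (r i) 0 * (ψ.toFun i).toReal =
      ∑ i ∈ s, max (-r i) 0 * (ψ.toFun i).toReal := by
    rw [← e1, ← e2]
    congr 2
    exact Subtype.ext e
  rw [← sub_eq_zero, ← Finset.sum_sub_distrib] at e3
  rw [← e3]
  refine Finset.sum_congr rfl fun i _ => ?_
  rw [← sub_mul, ← hd]

/-- A proper weight has a unique linear extension to `M_ψ`. -/
theorem existsUnique_extension {ψ : CStarWeight A} (hψ : ψ.IsProper) :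
    ∃! φ : ψ.mSpan →ₗ[ℂ] ℂ, ∀ (a : {a : A // 0 ≤ a}) (ha : (a : A) ∈ ψ.mSpan),
      φ ⟨a, ha⟩ = ((ψ.toFun a).toReal : ℂ) := by
  refine existsUnique_of_exists_of_unique ?_ ?_
  · let v : ψ.finCone → A := fun i => ((i : {a : A // 0 ≤ a}) : A)
    let L : (ψ.finCone →₀ ℂ) →ₗ[ℂ] A := Finsupp.linearCombination ℂ v
    let F : (ψ.finCone →₀ ℂ) →ₗ[ℂ] ℂ :=
      Finsupp.linearCombination ℂ fun i => ((ψ.toFun i).toReal : ℂ)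
    have hrange : ψ.mSpan = LinearMap.range L := by
      rw [mSpan_eq, Finsupp.range_linearCombination]
    have hker : LinearMap.ker L ≤ LinearMap.ker F := by
      have hre : ∀ c : ψ.finCone →₀ ℂ, L c = 0 → (F c).re = 0 := by
        intro c hc
        have h1 := sum_re_smul c.support c (fun i => (i : {a : A // 0 ≤ a}))
          (IsSelfAdjoint.zero A) hc
        have h2 := sum_real_eq_zero hψ c.support (fun i => (c i).re) h1
        have h3 : F c = ∑ i ∈ c.support, c i * ((ψ.toFun i).toReal : ℂ) := rfl
        rw [h3, Complex.re_sum, ← h2]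
        refine Finset.sum_congr rfl fun i _ => ?_
        simp
      intro c hc
      rw [LinearMap.mem_ker] at hc ⊢
      have h1 := hre c hc
      have h2 := hre (Complex.I • c) (by rw [_root_.map_smul, hc, smul_zero])
      rw [_root_.map_smul] at h2
      apply Complex.ext
      · simpa using h1
      · simpa using h2
    let e := L.quotKerEquivRange
    let φ : LinearMap.range L →ₗ[ℂ] ℂ := (LinearMap.ker L).liftQ F hker ∘ₗ e.symm.toLinearMap
    refine ⟨φ ∘ₗ (LinearEquiv.ofEq _ _ hrange).toLinearMap, fun a ha => ?_⟩
    have hfin : a ∈ ψ.finCone := toFun_lt_top_of_mem hψ ha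
    have hL : L (Finsupp.single ⟨a, hfin⟩ 1) = a := by simp [L, v]
    have h1 : (LinearEquiv.ofEq _ _ hrange) ⟨(a : A), ha⟩ =
        e (Submodule.Quotient.mk (Finsupp.single ⟨a, hfin⟩ 1)) := by
      apply Subtype.ext
      exact hL.symm
    simp only [LinearMap.comp_apply, LinearEquiv.coe_coe, h1, φ, LinearEquiv.symm_apply_apply]
    change F _ = _
    simp [F]
  · intro φ₁ φ₂ h₁ h₂
    apply LinearMap.ext
    rintro ⟨x, hx⟩
    have hx' := hx
    rw [mSpan_eq] at hx'
    induction hx' using Submodule.span_induction with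
    | mem y hy =>
      obtain ⟨a, rfl⟩ := hy
      rw [h₁ a.1 hx, h₂ a.1 hx]
    | zero =>
      have : (⟨0, hx⟩ : ψ.mSpan) = 0 := rfl
      rw [this, _root_.map_zero, _root_.map_zero]
    | add y z hy hz ihy ihz =>
      rw [← mSpan_eq] at hy hz
      have : (⟨y + z, hx⟩ : ψ.mSpan) = ⟨y, hy⟩ + ⟨z, hz⟩ := rfl
      rw [this, _root_.map_add, _root_.map_add, ihy hy, ihz hz]
    | smul c y hy ihy =>
      rw [← mSpan_eq] at hy
      have : (⟨c • y, hx⟩ : ψ.mSpan) = c • ⟨y, hy⟩ := rfl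
      rw [this, _root_.map_smul, _root_.map_smul, ihy hy]

/-- The linear extension of a proper weight `ψ` to `M_ψ`. -/
noncomputable def extension {ψ : CStarWeight A} (hψ : ψ.IsProper) : ψ.mSpan →ₗ[ℂ] ℂ :=
  (existsUnique_extension hψ).choose

lemma extension_apply {ψ : CStarWeight A} (hψ : ψ.IsProper) (a : {a : A // 0 ≤ a})
    (ha : (a : A) ∈ ψ.mSpan) : extension hψ ⟨a, ha⟩ = ((ψ.toFun a).toReal : ℂ) :=
  (existsUnique_extension hψ).choose_spec.1 a ha

/-- Invariance `ψ ∘ γ_t = ψ` for all `t`. -/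
def IsInvariant (ψ : CStarWeight A) (γ : OneParameterAutGroup A) : Prop :=
  ∀ (t : ℝ) (a : {a : A // 0 ≤ a}),
    ψ.toFun ⟨γ.toFun t a, map_nonneg (γ.toFun t) a.2⟩ = ψ.toFun a

lemma IsInvariant.apply_mem_nSet {ψ : CStarWeight A} {γ : OneParameterAutGroup A}
    (h : ψ.IsInvariant γ) {b : A} (hb : b ∈ ψ.nSet) (t : ℝ) : γ.toFun t b ∈ ψ.nSet := by
  have h1 := h t ⟨star b * b, star_mul_self_nonneg b⟩
  change ψ.toFun _ < ∞
  simp only [_root_.map_mul, map_star] at h1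
  rw [h1]
  exact hb

lemma IsInvariant.mul_apply_mem {ψ : CStarWeight A} {γ : OneParameterAutGroup A}
    (h : ψ.IsInvariant γ) {a b : A} (ha : star a ∈ ψ.nSet) (hb : b ∈ ψ.nSet) (t : ℝ) :
    a * γ.toFun t b ∈ ψ.mSpan :=
  Submodule.subset_span ⟨star a, ha, γ.toFun t b, h.apply_mem_nSet hb t, by rw [star_star]⟩

lemma IsInvariant.apply_mul_mem {ψ : CStarWeight A} {γ : OneParameterAutGroup A}
    (h : ψ.IsInvariant γ) {a b : A} (ha : a ∈ ψ.nSet) (hb : star b ∈ ψ.nSet) (t : ℝ) :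
    γ.toFun t b * a ∈ ψ.mSpan :=
  Submodule.subset_span ⟨γ.toFun t (star b), h.apply_mem_nSet hb t, a, ha, by
    rw [map_star, star_star]⟩

/-- The closed strip of complex numbers whose imaginary part lies between `0` and `β`
(`β` may be negative). -/
def strip (β : ℝ) : Set ℂ := {z | z.im ∈ Set.uIcc 0 β}

/-- `β`-KMS weights for `γ`: proper invariant weights such that for all `a, b` in the intersection
of `N_ψ` and its adjoint there is a bounded continuous function on the strip, holomorphic in its
interior, with boundary values `ψ(a γ_t(b))` and `ψ(γ_t(b) a)`. -/
structure IsKMS (ψ : CStarWeight A) (γ : OneParameterAutGroup A) (β : ℝ) : Prop where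
  proper : ψ.IsProper
  invariant : ψ.IsInvariant γ
  kms : ∀ (a b : A) (ha : a ∈ ψ.nSet) (ha' : star a ∈ ψ.nSet) (hb : b ∈ ψ.nSet)
    (hb' : star b ∈ ψ.nSet), ∃ F : ℂ → ℂ,
      ContinuousOn F (strip β) ∧ (∃ C : ℝ, ∀ z ∈ strip β, ‖F z‖ ≤ C) ∧
      DifferentiableOn ℂ F (interior (strip β)) ∧
      ∀ t : ℝ,
        F t = extension proper ⟨a * γ.toFun t b, invariant.mul_apply_mem ha' hb t⟩ ∧
        F (t + β * Complex.I) =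
          extension proper ⟨γ.toFun t b * a, invariant.apply_mul_mem ha hb' t⟩

end

end CStarWeight

/-! Since `ω ∘ P = ω` and `D` is abelian, elements of `D` of finite weight lie in the centralizer of
`ω`: for such `b` and suitable `x`, `ω(bx) = ω(P(bx)) = ω(bP(x)) = ω(P(x)b) = ω(P(xb)) = ω(xb)`. For
`b` in the centralizer the KMS function of a pair `(a, b)` takes equal values on the two edges of
the strip, so it extends `iβ`-periodically to a bounded entire function. Gluing across the edges is
Morera's theorem, and Liouville's theorem makes the extension constant
(`Complex.apply_ofReal_eq_of_periodic_strip`). Hence `ω(a γ_t(b)) = ω(ab)` for all `t`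
(`IsKMS.extension_mul_apply_eq`).

For self-adjoint `b`, the choice `a = γ_t(b) - b` gives `ω(a* a) = 0`, and faithfulness forces
`γ_t(b) = b` (`IsKMS.apply_eq_of_isSelfAdjoint`). This applies to `b = P(a)` with `a ≥ 0` of finite
weight. Density of these `a` in the positive cone, continuity of `P` and `γ_t`, and linearity extend
it to the whole range of `P`, which is `D`. -/

/-! ### Complex analysis: Morera gluing and Liouville on a strip. -/

/-- A continuous function on an open set which is holomorphic off the real line is holomorphic. -/
theorem Complex.differentiableOn_of_differentiableAt_off_real {f : ℂ → ℂ} {U : Set ℂ}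
    (hU : IsOpen U) (hc : ContinuousOn f U)
    (hd : ∀ z ∈ U, z.im ≠ 0 → DifferentiableAt ℂ f z) : DifferentiableOn ℂ f U := by
  rw [← isConservativeOn_and_continuousOn_iff_isDifferentiableOn hU]
  refine ⟨fun z w hzw => ?_, hc⟩
  rw [← add_eq_zero_iff_eq_neg, wedgeIntegral_add_wedgeIntegral_eq]
  -- Rectangles whose interior misses the real axis: Cauchy's theorem needs only continuity up to
  -- the boundary, so an edge may lie on the axis.
  have key : ∀ z w : ℂ, Set.uIcc z.re w.re ×ℂ Set.uIcc z.im w.im ⊆ U →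
      (0 : ℝ) ∉ Set.Ioo (min z.im w.im) (max z.im w.im) →
      (∫ x : ℝ in z.re..w.re, f (x + z.im * I)) - (∫ x : ℝ in z.re..w.re, f (x + w.im * I)) +
      I • (∫ y : ℝ in z.im..w.im, f (re w + y * I)) -
      I • (∫ y : ℝ in z.im..w.im, f (re z + y * I)) = 0 := by
    intro z w h h0
    refine integral_boundary_rect_eq_zero_of_continuousOn_of_differentiableOn f z w (hc.mono h) ?_
    intro v hv
    refine (hd v (h ⟨Set.Ioo_subset_Icc_self hv.1, Set.Ioo_subset_Icc_self hv.2⟩) ?_)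
      |>.differentiableWithinAt
    intro hv0
    exact h0 (hv0 ▸ hv.2)
  have hzw' : Set.uIcc z.re w.re ×ℂ Set.uIcc z.im w.im ⊆ U := hzw
  -- A rectangle crossing the axis is cut along it; the two integrals over the cut cancel.
  by_cases h0 : (0 : ℝ) ∈ Set.Ioo (min z.im w.im) (max z.im w.im)
  · have h0' : (0 : ℝ) ∈ Set.uIcc z.im w.im := Set.Ioo_subset_Icc_self h0
    have hl : Set.uIcc z.im 0 ⊆ Set.uIcc z.im w.im := Set.uIcc_subset_uIcc_left h0'
    have hr : Set.uIcc 0 w.im ⊆ Set.uIcc z.im w.im := Set.uIcc_subset_uIcc_right h0'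
    have h1 := key z (w.re : ℂ)
      (fun v hv => hzw' ⟨by simpa using hv.1, hl (by simpa using hv.2)⟩) (by
        simp only [ofReal_im]
        rintro ⟨h1, h2⟩
        grind)
    have h2 := key (z.re : ℂ) w
      (fun v hv => hzw' ⟨by simpa using hv.1, hr (by simpa using hv.2)⟩) (by
        simp only [ofReal_im]
        rintro ⟨h1, h2⟩
        grind)
    have hinter : ∀ x ∈ Set.uIcc z.re w.re, ∀ a b : ℝ, Set.uIcc a b ⊆ Set.uIcc z.im w.im →
        IntervalIntegrable (fun y : ℝ => f (x + y * I)) MeasureTheory.volume a b := by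
      intro x hx a b hab
      refine ContinuousOn.intervalIntegrable (hc.comp (by fun_prop) fun y hy => hzw' ⟨?_, ?_⟩)
      · simpa using hx
      · simpa using hab hy
    have e1 := intervalIntegral.integral_add_adjacent_intervals
      (hinter w.re Set.right_mem_uIcc _ _ hl) (hinter w.re Set.right_mem_uIcc _ _ hr)
    have e2 := intervalIntegral.integral_add_adjacent_intervals
      (hinter z.re Set.left_mem_uIcc _ _ hl) (hinter z.re Set.left_mem_uIcc _ _ hr)
    rw [← e1, ← e2]
    simp only [ofReal_im, ofReal_re, smul_eq_mul] at h1 h2 ⊢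
    linear_combination h1 + h2
  · exact key z w hzw' h0

/-- A bounded continuous function on a closed horizontal strip which is holomorphic in the interior
and takes the same values on both boundary lines is constant on the boundary. -/
theorem Complex.apply_ofReal_eq_of_periodic_strip {β : ℝ} (hβ : 0 < β) {F : ℂ → ℂ}
    (hc : ContinuousOn F {z | z.im ∈ Set.Icc 0 β}) {C : ℝ}
    (hb : ∀ z : ℂ, z.im ∈ Set.Icc 0 β → ‖F z‖ ≤ C)
    (hd : DifferentiableOn ℂ F {z | z.im ∈ Set.Ioo 0 β})
    (hp : ∀ t : ℝ, F (t + β * I) = F t) (s t : ℝ) : F s = F t := by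
  -- The `iβ`-periodic extension of `F`: each point is first translated into `0 ≤ Im z < β`.
  set E : ℂ → ℂ := fun z => F (z - (⌊z.im / β⌋ * β : ℝ) * I) with hE
  have hmem : ∀ z : ℂ, (z - (⌊z.im / β⌋ * β : ℝ) * I).im ∈ Set.Ico 0 β := by
    intro z
    have h1 := Int.floor_le (z.im / β)
    have h2 := Int.lt_floor_add_one (z.im / β)
    rw [le_div_iff₀ hβ] at h1
    rw [div_lt_iff₀ hβ] at h2
    simp only [sub_im, mul_im, ofReal_re, I_im, mul_one, ofReal_im, I_re, mul_zero, add_zero]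
    constructor <;> linarith
  have hper : ∀ (n : ℤ) (z : ℂ), E (z + (n * β : ℝ) * I) = E z := by
    intro n z
    have h1 : (z + (n * β : ℝ) * I).im / β = z.im / β + n := by
      simp only [add_im, mul_im, ofReal_re, I_im, mul_one, ofReal_im, I_re, mul_zero, add_zero]
      field_simp
    simp only [hE, h1, Int.floor_add_intCast]
    congr 1
    push_cast
    ring
  have hEF : ∀ z : ℂ, z.im ∈ Set.Icc 0 β → E z = F z := by
    intro z hz
    rcases hz.2.lt_or_eq with h | h
    · have : ⌊z.im / β⌋ = 0 := by
        rw [Int.floor_eq_zero_iff]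
        exact ⟨div_nonneg hz.1 hβ.le, (div_lt_one hβ).2 h⟩
      simp [hE, this]
    -- The top edge is folded onto the real line, so agreement of `E` and `F` there is exactly `hp`.
    · have h1 : z = z.re + β * I := by rw [← h, re_add_im]
      have h2 : ⌊z.im / β⌋ = 1 := by rw [h, div_self hβ.ne']; simp
      have h3 : z - (⌊z.im / β⌋ * β : ℝ) * I = z.re := by
        rw [h2]; nth_rw 1 [h1]; simp
      simp only [hE]
      rw [h3, ← hp, ← h1]
  have hEc : ContinuousOn E {z | z.im ∈ Set.Icc 0 β} := hc.congr fun z hz => hEF z hz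
  have hEc' : ContinuousOn E {z | z.im ∈ Set.Icc (-β) 0} := by
    have h1 : ContinuousOn (fun z : ℂ => E (z + ((1 : ℤ) * β : ℝ) * I))
        {z | z.im ∈ Set.Icc (-β) 0} := by
      refine hEc.comp (by fun_prop) fun z hz => ?_
      have hz' : -β ≤ z.im ∧ z.im ≤ 0 := hz
      simp only [Set.mem_ofPred_eq, Set.mem_Icc, add_im, mul_im, ofReal_re, I_im, mul_one,
        ofReal_im, I_re, mul_zero, add_zero, Int.cast_one, one_mul]
      constructor <;> linarith
    exact h1.congr fun z _ => (hper 1 z).symm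
  have hcl : ∀ a b : ℝ, IsClosed {z : ℂ | z.im ∈ Set.Icc a b} := fun a b =>
    isClosed_Icc.preimage continuous_im
  have hop : ∀ a b : ℝ, IsOpen {z : ℂ | z.im ∈ Set.Ioo a b} := fun a b =>
    isOpen_Ioo.preimage continuous_im
  have hEd : ∀ z : ℂ, z.im ∈ Set.Ioo 0 β → DifferentiableAt ℂ E z := by
    intro z hz
    have h1 : DifferentiableOn ℂ E {z | z.im ∈ Set.Ioo 0 β} :=
      hd.congr fun w hw => hEF w (Set.Ioo_subset_Icc_self hw)
    exact h1.differentiableAt ((hop 0 β).mem_nhds hz)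
  have hshift : ∀ (n : ℤ) (z : ℂ), DifferentiableAt ℂ E (z + (n * β : ℝ) * I) →
      DifferentiableAt ℂ E z := by
    intro n z h
    have h1 : DifferentiableAt ℂ (fun w : ℂ => E (w + (n * β : ℝ) * I)) z :=
      DifferentiableAt.comp (g := E) (f := fun w : ℂ => w + (n * β : ℝ) * I) z h (by fun_prop)
    simpa only [hper] using h1
  -- The real axis is the only seam in this open strip, and every point of the plane has a translate
  -- in it.
  have hmid : DifferentiableOn ℂ E {z | z.im ∈ Set.Ioo (-β) β} := by
    refine differentiableOn_of_differentiableAt_off_real (hop _ _) ?_ ?_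
    · refine (hEc.union_of_isClosed hEc' (hcl _ _) (hcl _ _)).mono fun z hz => ?_
      rcases le_total 0 z.im with h | h
      · exact Or.inl ⟨h, hz.2.le⟩
      · exact Or.inr ⟨hz.1.le, h⟩
    · intro z hz h0
      have hz' : -β < z.im ∧ z.im < β := hz
      rcases lt_or_gt_of_ne h0 with h | h
      · refine hshift 1 z (hEd _ ?_)
        simp only [Set.mem_Ioo, add_im, mul_im, ofReal_re, I_im, mul_one,
          ofReal_im, I_re, mul_zero, add_zero, Int.cast_one, one_mul]
        constructor <;> linarith
      · exact hEd z ⟨h, hz.2⟩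
  have hdiff : Differentiable ℂ E := by
    intro z
    refine hshift (-⌊z.im / β⌋) z (hmid.differentiableAt ((hop _ _).mem_nhds ?_))
    have h1 := hmem z
    have h2 : z + ((-⌊z.im / β⌋ : ℤ) * β : ℝ) * I = z - (⌊z.im / β⌋ * β : ℝ) * I := by
      push_cast; ring
    rw [h2]
    exact ⟨by linarith [h1.1], h1.2⟩
  have hbdd : Bornology.IsBounded (Set.range E) := by
    refine isBounded_iff_forall_norm_le.2 ⟨C, ?_⟩
    rintro _ ⟨z, rfl⟩
    exact hb _ (Set.Ico_subset_Icc_self (hmem z))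
  have h := hdiff.apply_eq_apply_of_bounded hbdd s t
  rwa [hEF _ (by simp [hβ.le]), hEF _ (by simp [hβ.le])] at h

/-! ### Group laws of the automorphism group. -/

namespace OneParameterAutGroup

variable {A : Type*} [NonUnitalCStarAlgebra A]

lemma apply_zero (γ : OneParameterAutGroup A) (a : A) : γ.toFun 0 a = a := by
  have h := γ.map_add 0 0
  rw [add_zero, left_eq_mul] at h
  rw [h]
  rfl

lemma apply_neg_apply (γ : OneParameterAutGroup A) (t : ℝ) (a : A) :
    γ.toFun (-t) (γ.toFun t a) = a := by
  have h := γ.map_add (-t) t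
  rw [neg_add_cancel] at h
  exact (congrArg (fun e : A ≃⋆ₐ[ℂ] A => e a) h).symm.trans (γ.apply_zero a)

end OneParameterAutGroup

/-! ### Invariance of the extended weight, and the centralizer of a KMS weight. -/

namespace CStarWeight

variable {A : Type*} [NonUnitalCStarAlgebra A] [PartialOrder A] [StarOrderedRing A]

/-- The linear extension of a proper weight is invariant under every positive linear map which
preserves the weight. -/
lemma extension_apply_map {ψ : CStarWeight A} (hψ : ψ.IsProper) (T : A →ₗ[ℂ] A)
    (hT : ∀ a : A, 0 ≤ a → 0 ≤ T a)
    (hTψ : ∀ a : {a : A // 0 ≤ a}, ψ.toFun ⟨T a, hT a a.2⟩ = ψ.toFun a) {x : A}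
    (hx : x ∈ ψ.mSpan) :
    ∃ h : T x ∈ ψ.mSpan, extension hψ ⟨T x, h⟩ = extension hψ ⟨x, hx⟩ := by
  have hx' := hx
  rw [mSpan_eq] at hx'
  induction hx' using Submodule.span_induction with
  | mem y hy =>
    obtain ⟨a, rfl⟩ := hy
    have hfin : (⟨T a.1, hT _ a.1.2⟩ : {a : A // 0 ≤ a}) ∈ ψ.finCone :=
      (hTψ a.1).trans_lt a.2
    refine ⟨finCone_mem_mSpan hfin, ?_⟩
    rw [extension_apply hψ a.1 hx, ← hTψ a.1]
    exact extension_apply hψ ⟨T a.1, hT _ a.1.2⟩ (finCone_mem_mSpan hfin)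
  | zero =>
    refine ⟨by rw [_root_.map_zero]; exact zero_mem _, ?_⟩
    congr 2
    exact _root_.map_zero T
  | add y z hy hz ihy ihz =>
    rw [← mSpan_eq] at hy hz
    obtain ⟨h1, e1⟩ := ihy hy
    obtain ⟨h2, e2⟩ := ihz hz
    refine ⟨by rw [_root_.map_add]; exact add_mem h1 h2, ?_⟩
    have e : extension hψ ⟨T y, h1⟩ + extension hψ ⟨T z, h2⟩ =
        extension hψ ⟨y, hy⟩ + extension hψ ⟨z, hz⟩ := by rw [e1, e2]
    rw [← _root_.map_add, ← _root_.map_add] at e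
    convert e using 3
    · exact _root_.map_add T y z
    · rfl
  | smul c y hy ihy =>
    rw [← mSpan_eq] at hy
    obtain ⟨h1, e1⟩ := ihy hy
    refine ⟨by rw [_root_.map_smul]; exact Submodule.smul_mem _ c h1, ?_⟩
    have e : c • extension hψ ⟨T y, h1⟩ = c • extension hψ ⟨y, hy⟩ := by rw [e1]
    rw [← _root_.map_smul, ← _root_.map_smul] at e
    convert e using 3
    · exact _root_.map_smul T c y
    · rfl

lemma extension_congr {ψ : CStarWeight A} (hψ : ψ.IsProper) {x y : A} (hx : x ∈ ψ.mSpan)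
    (h : x = y) : extension hψ ⟨x, hx⟩ = extension hψ ⟨y, h ▸ hx⟩ := by
  subst h
  rfl

lemma IsInvariant.extension_apply {ψ : CStarWeight A} (hψ : ψ.IsProper)
    {γ : OneParameterAutGroup A} (hγ : ψ.IsInvariant γ) (t : ℝ) {x : A} (hx : x ∈ ψ.mSpan) :
    ∃ h : γ.toFun t x ∈ ψ.mSpan, extension hψ ⟨γ.toFun t x, h⟩ = extension hψ ⟨x, hx⟩ :=
  extension_apply_map hψ ((γ.toFun t : A →ₗ[ℂ] A)) (fun _ ha => map_nonneg (γ.toFun t) ha)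
    (fun a => hγ t a) hx

lemma mul_mem_mSpan {ψ : CStarWeight A} {a b : A} (ha : star a ∈ ψ.nSet) (hb : b ∈ ψ.nSet) :
    a * b ∈ ψ.mSpan :=
  Submodule.subset_span ⟨star a, ha, b, hb, by rw [star_star]⟩

/-- Conjugating `b ≤ ‖b‖` by the square root of `b` gives `b² ≤ ‖b‖ b`. -/
lemma mem_nSet_of_toFun_lt_top {ψ : CStarWeight A} {b : A} (hb : 0 ≤ b)
    (h : ψ.toFun ⟨b, hb⟩ < ∞) : b ∈ ψ.nSet := by
  have hsa : IsSelfAdjoint b := .of_nonneg hb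
  have hs : star (CFC.sqrt b) = CFC.sqrt b :=
    (IsSelfAdjoint.of_nonneg (CFC.sqrt_nonneg b)).star_eq
  have hss : CFC.sqrt b * CFC.sqrt b = b := CFC.sqrt_mul_sqrt_self b hb
  -- The added `1` covers `b = 0`, since homogeneity of a weight requires a strictly positive
  -- scalar.
  have hpos : 0 < ‖b‖ + 1 := by positivity
  have hle : star b * b ≤ (‖b‖ + 1) • b := by
    have h1 := CStarAlgebra.star_left_conjugate_le_norm_smul (a := CFC.sqrt b) hsa
    have h2 : CFC.sqrt b * b * CFC.sqrt b = b * b := by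
      calc CFC.sqrt b * b * CFC.sqrt b
          = CFC.sqrt b * (CFC.sqrt b * CFC.sqrt b) * CFC.sqrt b := by rw [hss]
        _ = (CFC.sqrt b * CFC.sqrt b) * (CFC.sqrt b * CFC.sqrt b) := by simp only [mul_assoc]
        _ = b * b := by rw [hss]
    rw [hs, hss, h2] at h1
    rw [hsa.star_eq, add_smul, one_smul]
    exact h1.trans (le_add_of_nonneg_right hb)
  refine (ψ.mono (star_mul_self_nonneg b) (smul_nonneg hpos.le hb) hle).trans_lt ?_
  rw [ψ.map_smul _ hpos ⟨b, hb⟩]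
  exact ENNReal.mul_lt_top ENNReal.ofReal_lt_top h

/-- An element of the centralizer of a KMS weight `ψ`, for a non-zero inverse temperature, has
constant correlation functions `t ↦ ψ(a γ_t(b))`. -/
lemma IsKMS.extension_mul_apply_eq {ψ : CStarWeight A} {γ : OneParameterAutGroup A} {β : ℝ}
    (hψ : ψ.IsKMS γ β) (hβ : β ≠ 0) {a b : A} (ha : a ∈ ψ.nSet) (ha' : star a ∈ ψ.nSet)
    (hb : b ∈ ψ.nSet) (hb' : star b ∈ ψ.nSet)
    (hcomm : ∀ (x : A) (hx : x ∈ ψ.nSet) (hx' : star x ∈ ψ.nSet),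
      extension hψ.proper ⟨b * x, mul_mem_mSpan hb' hx⟩ =
        extension hψ.proper ⟨x * b, mul_mem_mSpan hx' hb⟩) (t : ℝ) :
    extension hψ.proper ⟨a * γ.toFun t b, hψ.invariant.mul_apply_mem ha' hb t⟩ =
      extension hψ.proper ⟨a * b, mul_mem_mSpan ha' hb⟩ := by
  obtain ⟨F, hc, ⟨C, hC⟩, hd, hF⟩ := hψ.kms a b ha ha' hb hb'
  -- Invariance under `γ_{-t}` moves the time from `b` to `a`, and `hcomm` then applies with `x =
  -- γ_{-t}(a)`.
  have hp : ∀ t : ℝ, F (t + β * Complex.I) = F t := by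
    intro t
    rw [(hF t).1, (hF t).2]
    have hx : γ.toFun (-t) a ∈ ψ.nSet := hψ.invariant.apply_mem_nSet ha (-t)
    have hx' : star (γ.toFun (-t) a) ∈ ψ.nSet := by
      rw [← map_star]
      exact hψ.invariant.apply_mem_nSet ha' (-t)
    obtain ⟨h1, e1⟩ := hψ.invariant.extension_apply hψ.proper (-t)
      (hψ.invariant.apply_mul_mem ha hb' t)
    obtain ⟨h2, e2⟩ := hψ.invariant.extension_apply hψ.proper (-t)
      (hψ.invariant.mul_apply_mem ha' hb t)
    rw [← e1, ← e2, extension_congr hψ.proper h1 (y := b * γ.toFun (-t) a)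
      (by rw [_root_.map_mul, γ.apply_neg_apply]), extension_congr hψ.proper h2
      (y := γ.toFun (-t) a * b) (by rw [_root_.map_mul, γ.apply_neg_apply])]
    exact hcomm _ hx hx'
  have key : F t = F (0 : ℝ) := by
    rcases hβ.lt_or_gt with hneg | hpos
    · have hstrip : strip β = {z : ℂ | z.im ∈ Set.Icc β 0} := by
        rw [strip, Set.uIcc_of_ge hneg.le]
      have hinter : interior (strip β) = {z : ℂ | z.im ∈ Set.Ioo β 0} := by
        rw [hstrip]
        exact (Complex.interior_preimage_im _).trans (by rw [interior_Icc]; rfl)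
      rw [hstrip] at hc hC
      rw [hinter] at hd
      have hshift : ∀ z : ℂ, (z + β * Complex.I).im = z.im + β := fun z => by simp
      -- For negative `β`, translation by `iβ` carries the strip `[0, -β]` onto `[β, 0]`; by `hp`
      -- the translate has the same values on the real line.
      have h := Complex.apply_ofReal_eq_of_periodic_strip (β := -β) (by linarith)
        (F := fun z => F (z + β * Complex.I)) (C := C)
        (hc.comp (by fun_prop) fun z hz => ?_) (fun z hz => hC _ ?_)
        (hd.comp (by fun_prop) fun z hz => ?_) (fun s => ?_) t 0
      · simpa only [hp] using h
      · have hz' : 0 ≤ z.im ∧ z.im ≤ -β := hz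
        exact ⟨by rw [hshift]; linarith, by rw [hshift]; linarith⟩
      · exact ⟨by rw [hshift]; linarith [hz.1], by rw [hshift]; linarith [hz.2]⟩
      · have hz' : 0 < z.im ∧ z.im < -β := hz
        exact ⟨by rw [hshift]; linarith, by rw [hshift]; linarith⟩
      · rw [hp]
        congr 1
        push_cast
        ring
    · have hstrip : strip β = {z : ℂ | z.im ∈ Set.Icc 0 β} := by
        rw [strip, Set.uIcc_of_le hpos.le]
      have hinter : interior (strip β) = {z : ℂ | z.im ∈ Set.Ioo 0 β} := by
        rw [hstrip]
        exact (Complex.interior_preimage_im _).trans (by rw [interior_Icc]; rfl)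
      rw [hstrip] at hc hC
      rw [hinter] at hd
      exact Complex.apply_ofReal_eq_of_periodic_strip hpos hc hC hd hp t 0
  rw [← (hF t).1, key, (hF 0).1]
  exact extension_congr _ _ (by rw [γ.apply_zero])

/-- A self-adjoint element of finite weight in the centralizer of a faithful KMS weight is fixed
by the automorphism group. -/
lemma IsKMS.apply_eq_of_isSelfAdjoint {ψ : CStarWeight A} {γ : OneParameterAutGroup A} {β : ℝ}
    (hψ : ψ.IsKMS γ β) (hβ : β ≠ 0) (hfaith : ψ.IsFaithful) {b : A} (hsa : IsSelfAdjoint b)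
    (hb : b ∈ ψ.nSet) (hb' : star b ∈ ψ.nSet)
    (hcomm : ∀ (x : A) (hx : x ∈ ψ.nSet) (hx' : star x ∈ ψ.nSet),
      extension hψ.proper ⟨b * x, mul_mem_mSpan hb' hx⟩ =
        extension hψ.proper ⟨x * b, mul_mem_mSpan hx' hb⟩) (t : ℝ) :
    γ.toFun t b = b := by
  set c : A := γ.toFun t b + (-1 : ℂ) • b with hc
  have hcN : c ∈ ψ.nSet :=
    add_mem_nSet (hψ.invariant.apply_mem_nSet hb t) (smul_mem_nSet hb (by simp))
  have hcs : star c = c := by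
    simp [hc, ← map_star, hsa.star_eq]
  have hcN' : star c ∈ ψ.nSet := by rwa [hcs]
  have h1 := hψ.extension_mul_apply_eq hβ hcN hcN' hb hb' hcomm t
  have hmem : star c * c ∈ ψ.mSpan := mul_mem_mSpan (by rwa [star_star]) hcN
  -- As `c` is self-adjoint, `c* c = c γ_t(b) - c b`, and by `h1` both terms have the same weight.
  have h2 : extension hψ.proper ⟨star c * c, hmem⟩ = 0 := by
    have e : (⟨star c * c, hmem⟩ : ψ.mSpan) =
        ⟨c * γ.toFun t b, hψ.invariant.mul_apply_mem hcN' hb t⟩ -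
          ⟨c * b, mul_mem_mSpan hcN' hb⟩ := by
      apply Subtype.ext
      change star c * c = c * γ.toFun t b - c * b
      rw [hcs, ← mul_sub, hc]
      simp [sub_eq_add_neg]
    rw [e, _root_.map_sub, h1, sub_self]
  have h3 := extension_apply hψ.proper ⟨star c * c, star_mul_self_nonneg c⟩ hmem
  rw [h2] at h3
  have h4 : (ψ.toFun ⟨star c * c, star_mul_self_nonneg c⟩).toReal = 0 := by
    exact_mod_cast h3.symm
  -- `toReal` also vanishes at `∞`, which `hcN` excludes.
  have h5 : ψ.toFun ⟨star c * c, star_mul_self_nonneg c⟩ = 0 :=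
    ((ENNReal.toReal_eq_zero_iff _).1 h4).resolve_right (ne_of_lt hcN)
  have h6 : c = 0 := (CStarRing.star_mul_self_eq_zero_iff c).1 (hfaith _ h5)
  rw [hc, neg_one_smul, ← sub_eq_add_neg, sub_eq_zero] at h6
  exact h6

end CStarWeight

/-! ### The theorem: elements of `D` are fixed. -/

theorem mainTheorem5 {A : Type*} [NonUnitalCStarAlgebra A] [PartialOrder A] [StarOrderedRing A]
    (γ : OneParameterAutGroup A)
    (D : NonUnitalStarSubalgebra ℂ A) (hD_closed : IsClosed (D : Set A))
    (hD_comm : ∀ x ∈ D, ∀ y ∈ D, x * y = y * x)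
    (P : A →ₗ[ℂ] D) (hP : IsConditionalExpectation D P)
    (ω : CStarWeight A) (β : ℝ) (hβ : β ≠ 0)
    (hω : ω.IsKMS γ β) (hω_faithful : ω.IsFaithful)
    (hωP : ∀ a : {a : A // 0 ≤ a}, ω.toFun ⟨(P a : A), hP.nonneg a a.2⟩ = ω.toFun a) :
    ∀ (t : ℝ), ∀ d ∈ D, γ.toFun t d = d := by
  intro t
  let Q : A →ₗ[ℂ] A := D.toSubmodule.subtype ∘ₗ P
  have hQ : ∀ a, Q a = (P a : A) := fun _ => rfl
  have hQc : Continuous Q :=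
    (Q.mkContinuous 1 fun a => by simpa [hQ] using hP.norm_le a).continuous
  have hγc : Continuous (γ.toFun t) :=
    (NonUnitalStarAlgHom.isometry (γ.toFun t) (γ.toFun t).injective).continuous
  have hfin : ∀ a : {a : A // 0 ≤ a}, ω.toFun a < ∞ → γ.toFun t (Q a) = Q a := by
    intro a ha
    have hb0 : 0 ≤ Q a := hP.nonneg a a.2
    have hsa : IsSelfAdjoint (Q a) := .of_nonneg hb0
    have hb : Q a ∈ ω.nSet :=
      CStarWeight.mem_nSet_of_toFun_lt_top hb0 ((hωP a).trans_lt ha)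
    have hb' : star (Q a) ∈ ω.nSet := by rwa [hsa.star_eq]
    refine hω.apply_eq_of_isSelfAdjoint hβ hω_faithful hsa hb hb' (fun x hx hx' => ?_) t
    obtain ⟨h1, e1⟩ := CStarWeight.extension_apply_map hω.proper Q hP.nonneg hωP
      (CStarWeight.mul_mem_mSpan hb' hx)
    obtain ⟨h2, e2⟩ := CStarWeight.extension_apply_map hω.proper Q hP.nonneg hωP
      (CStarWeight.mul_mem_mSpan hx' hb)
    -- After applying `P` inside the weight, both products are products of `P a` and `P x` in `D`,
    -- which commute.
    rw [← e1, ← e2]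
    refine CStarWeight.extension_congr _ _ ?_
    rw [hQ, hQ (x * _), hQ a, hP.map_mul_left, hP.map_mul_right]
    exact hD_comm _ (P a).2 _ (P x).2
  have hpos : ∀ a : {a : A // 0 ≤ a}, γ.toFun t (Q a) = Q a := by
    have hcl : IsClosed {a : {a : A // 0 ≤ a} | γ.toFun t (Q a) = Q a} :=
      isClosed_eq (hγc.comp (hQc.comp continuous_subtype_val))
        (hQc.comp continuous_subtype_val)
    intro a
    exact hcl.closure_subset_iff.2 hfin (hω.proper.dense a)
  have hall : ∀ a : A, γ.toFun t (Q a) = Q a := by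
    intro a
    -- Positive elements span a C*-algebra, so linearity suffices.
    have ha : a ∈ Submodule.span ℂ {a : A | 0 ≤ a} := by
      rw [CStarAlgebra.span_nonneg]
      trivial
    induction ha using Submodule.span_induction with
    | mem x hx => exact hpos ⟨x, hx⟩
    | zero => simp
    | add x y _ _ hx hy => simp only [map_add, hx, hy]
    | smul c x _ hx => simp only [map_smul, hx]
  intro d hd
  have h := hall d
  rwa [hQ, hP.apply_self ⟨d, hd⟩] at h
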